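/- For integers $N\ge 1$ and $k\ge 1$ let $$T(N,k):=\{x=(x_0,\dots,x_k)\in\{0,1,\dots,N-1\}^{k+1} : x_0+\cdots+x_k=N-1\},$$ and let $E_{k+1}\subset\mathbb Z^{k+1}$ be the set of the $k+1$ standard unit vectors. For every real $\delta>0$ and every integer $k\ge 1$ there is an $\varepsilon>0$ such that, for every sufficiently large integer $N$ (how large depending only on $\delta$ and $k$), the following holds for every subset $S\subset T(N,k)$ with $|S|\ge\delta N^k$. There exists a vector $a=(a_0,\dots,a_k)\in\mathbb Z^{k+1}\setminus T(N,k)$ such that $$a+cE_{k+1}\subset S,\qquad\text{where } c:=N-1-\sum_{i=0}^k a_i\neq 0.$$ Furthermore, there are at least $\varepsilon N^{k+1}$ such vectors $a$. -/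

import Mathlib

/-- The simplex slice `T(N, k)`: the points `x = (x_0, …, x_k)` of `{0, 1, …, N - 1}^{k+1}`
with `x_0 + ⋯ + x_k = N - 1`, as a subset of `ℤ^{k+1}`. -/
def simplexSlice (N k : ℕ) : Set (Fin (k + 1) → ℤ) :=
  {x | (∀ i, 0 ≤ x i ∧ x i ≤ (N : ℤ) - 1) ∧ ∑ i, x i = (N : ℤ) - 1}

/-- The set `E_r` of the `r` standard unit vectors of `ℤ^r`. -/
def unitVectors (r : ℕ) : Set (Fin r → ℤ) :=
  Set.range fun i : Fin r => (Pi.single i 1 : Fin r → ℤ)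

/-- The number `c = N - 1 - (a_0 + ⋯ + a_k)` attached to `a ∈ ℤ^{k+1}`. -/
def slack (N : ℕ) {k : ℕ} (a : Fin (k + 1) → ℤ) : ℤ :=
  (N : ℤ) - 1 - ∑ i, a i

/-- The vectors `a ∈ ℤ^{k+1} \ T(N, k)` with `c = N - 1 - (a_0 + ⋯ + a_k) ≠ 0` and
`a + c E_{k+1} ⊆ S`. -/
def simplexApexes (N k : ℕ) (S : Set (Fin (k + 1) → ℤ)) : Set (Fin (k + 1) → ℤ) :=
  {a | a ∉ simplexSlice N k ∧ slack N a ≠ 0 ∧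
    (fun e => a + slack N a • e) '' unitVectors (k + 1) ⊆ S}

/-! The theorem is deduced from the density Hales-Jewett theorem for k+1 letters. Fix a word length
n. For a translate t and a dilation d > 0, send a word w to t + d • `letterCount w`. A combinatorial
line then maps to a + c E, where a comes from its constant coordinates and c is d times its number
of active ones, so c ≠ 0. Averaging over all (t, d) of the right size, a positive proportion pull S
back to a dense set of words, hence to one containing a line. There are boundedly many lines, so one
line serves a positive proportion of the roughly N^(k+1) pairs. The pair can be recovered from a.

Density Hales-Jewett is proved by adding one letter `none` to an alphabet κ
(`DensityHalesJewett.option`). If it fails, let δ > 0 be the limiting maximal density of line-free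
sets and take a line-free A of nearly this density. By extremality, every section of A over a
bounded set of coordinates has density nearly δ. The theorem for κ then gives a small piece of A
where a set C of density nearly δ on average meets an intersection D of sets F_i almost nowhere,
with D of average density at least θ. Each F_i does not distinguish `none` from i.

The complement of D splits into intersections of sets of the same kind. Sets of this kind are almost
partitioned by subspaces of large dimension
(`DensityHalesJewett.expect_indicator_forall_collapse_le`), and on each such subspace the line-free
set C has density barely above δ. So C has density at most about δ(1 - θ) on average, a
contradiction. -/

open Combinatorics
open scoped BigOperators

/-! ### Densities and averages on finite types -/

section Density

variable {X Y : Type*} [Fintype X] [Fintype Y]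

/-- The density of a subset of a finite type. -/
noncomputable def density (A : Set X) : ℝ := 𝔼 x, A.indicator (fun _ => (1 : ℝ)) x

lemma expect_mono {f g : X → ℝ} (h : ∀ x, f x ≤ g x) : 𝔼 x, f x ≤ 𝔼 x, g x :=
  Finset.expect_le_expect fun x _ => h x

lemma density_nonneg (A : Set X) : 0 ≤ density A :=
  Finset.expect_nonneg fun _ _ => Set.indicator_nonneg (fun _ _ => zero_le_one) _

lemma density_mono {A B : Set X} (h : A ⊆ B) : density A ≤ density B :=
  expect_mono fun _ => Set.indicator_le_indicator_of_subset h (fun _ => zero_le_one) _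

lemma density_univ [Nonempty X] : density (Set.univ : Set X) = 1 := by
  simp [density]

lemma density_le_one (A : Set X) : density A ≤ 1 := by
  rcases isEmpty_or_nonempty X with h | h
  · simp [density]
  · exact (density_mono (Set.subset_univ A)).trans density_univ.le

lemma density_empty : density (∅ : Set X) = 0 := by
  simp [density]

lemma density_eq_ncard (A : Set X) : density A = A.ncard / Fintype.card X := by
  classical
  rw [density, Fintype.expect_eq_sum_div_card, Finset.sum_indicator_eq_sum_filter,
    Finset.sum_const, nsmul_eq_mul, mul_one, Set.ncard_eq_toFinset_card']
  congr 3
  ext x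
  simp

lemma density_preimage_equiv (e : X ≃ Y) (A : Set Y) : density (e ⁻¹' A) = density A :=
  Fintype.expect_equiv e _ _ fun _ => rfl

lemma expect_prod (f : X × Y → ℝ) : 𝔼 p, f p = 𝔼 x, 𝔼 y, f (x, y) :=
  Finset.expect_product Finset.univ Finset.univ f

lemma expect_prod_comm (f : X × Y → ℝ) : 𝔼 p, f p = 𝔼 y, 𝔼 x, f (x, y) := by
  rw [expect_prod, Finset.expect_comm]

lemma density_prod (A : Set (X × Y)) : density A = 𝔼 x, density {y | (x, y) ∈ A} :=
  expect_prod _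

lemma density_inter_add_diff (A B : Set X) : density (A ∩ B) + density (A \ B) = density A := by
  rw [density, density, density, ← Finset.expect_add_distrib]
  refine Finset.expect_congr rfl fun x _ => ?_
  by_cases hA : x ∈ A <;> by_cases hB : x ∈ B <;> simp [hA, hB]

lemma density_iUnion_le {L : Type*} [Fintype L] (G : L → Set X) :
    density (⋃ l, G l) ≤ ∑ l, density (G l) := by
  rw [show ∑ l, density (G l) = 𝔼 x, ∑ l, (G l).indicator (fun _ => (1 : ℝ)) x from
    (Finset.expect_sum_comm _ _ _).symm]
  refine expect_mono fun x => ?_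
  have hn : ∀ l ∈ Finset.univ, 0 ≤ (G l).indicator (fun _ => (1 : ℝ)) x := fun l _ =>
    Set.indicator_nonneg (fun _ _ => zero_le_one) _
  by_cases hx : x ∈ ⋃ l, G l
  · obtain ⟨l, hl⟩ := Set.mem_iUnion.1 hx
    refine le_trans ?_ (Finset.single_le_sum hn (Finset.mem_univ l))
    simp [hx, hl]
  · simpa [hx] using Finset.sum_nonneg hn

lemma exists_density_ge {L : Type*} [Fintype L] [Nonempty L] {A : Set X} (G : L → Set X)
    (h : A ⊆ ⋃ l, G l) : ∃ l, density A / Fintype.card L ≤ density (G l) := by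
  have := (density_mono h).trans (density_iUnion_le G)
  obtain ⟨l, -, hl⟩ := Finset.exists_le_of_sum_le (s := Finset.univ)
    (f := fun _ => density A / Fintype.card L) (g := fun l => density (G l))
    Finset.univ_nonempty (by
      rw [Finset.sum_const, nsmul_eq_mul, Finset.card_univ, mul_div_cancel₀]
      · exact this
      · exact_mod_cast Fintype.card_ne_zero)
  exact ⟨l, hl⟩

/-- Points with g below δ / 2 contribute at most δ / 2 to the average, so the rest must come from
points where g is large. -/
lemma half_le_density_half_le [Nonempty X] {g : X → ℝ} {δ : ℝ} (hδ : 0 ≤ δ) (hg : ∀ x, g x ≤ 1)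
    (h : δ ≤ 𝔼 x, g x) : δ / 2 ≤ density {x | δ / 2 ≤ g x} := by
  have : 𝔼 x, g x ≤ 𝔼 x, ({x | δ / 2 ≤ g x}.indicator (fun _ => (1 : ℝ)) x + δ / 2) := by
    refine expect_mono fun x => ?_
    by_cases hx : δ / 2 ≤ g x
    · simp only [Set.indicator, Set.mem_ofPred_eq, hx, if_true]
      linarith [hg x]
    · simp only [Set.indicator, Set.mem_ofPred_eq, hx, if_false]
      linarith
  rw [Finset.expect_add_distrib, Fintype.expect_const] at this
  change _ ≤ density _ + _ at this
  linarith

lemma exists_ge_of_le_expect [Nonempty X] {g : X → ℝ} {a : ℝ} (h : a ≤ 𝔼 x, g x) : ∃ x, a ≤ g x :=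
  let ⟨x, _, hx⟩ := Finset.exists_le_of_le_expect Finset.univ_nonempty h
  ⟨x, hx⟩

lemma nonempty_of_density_pos {A : Set X} (h : 0 < density A) : A.Nonempty := by
  by_contra hA
  rw [Set.not_nonempty_iff_eq_empty.1 hA, density_empty] at h
  exact h.false

lemma one_div_card_le_density {A : Set X} (h : A.Nonempty) : 1 / Fintype.card X ≤ density A := by
  rw [density_eq_ncard]
  have : 1 ≤ A.ncard := (Set.ncard_pos A.toFinite).2 h
  gcongr
  exact_mod_cast this

end Density

/-! ### Words, lines and combinatorial subspaces -/

section Words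

variable {α ι ι' : Type*} [Fintype α] [Fintype ι] [Fintype ι'] [DecidableEq ι] [DecidableEq ι']

lemma expect_sum_arrow (f : (ι ⊕ ι' → α) → ℝ) : 𝔼 z, f z = 𝔼 s, 𝔼 y, f (Sum.elim s y) := by
  rw [← expect_prod fun p : (ι → α) × (ι' → α) => f (Sum.elim p.1 p.2)]
  refine Fintype.expect_equiv (Equiv.sumArrowEquivProdArrow ι ι' α) _ _ fun z => ?_
  rw [show Sum.elim (Equiv.sumArrowEquivProdArrow ι ι' α z).1
    (Equiv.sumArrowEquivProdArrow ι ι' α z).2 = z from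
    (Equiv.sumArrowEquivProdArrow ι ι' α).symm_apply_apply z]

lemma expect_sum_arrow_comm (f : (ι ⊕ ι' → α) → ℝ) : 𝔼 z, f z = 𝔼 y, 𝔼 s, f (Sum.elim s y) := by
  rw [expect_sum_arrow, Finset.expect_comm]

lemma expect_comp_equiv (e : ι ≃ ι') (f : (ι → α) → ℝ) :
    𝔼 z, f z = 𝔼 w : ι' → α, f (w ∘ e) :=
  Fintype.expect_equiv (Equiv.arrowCongr e (Equiv.refl α)) _ _ fun z => by
    congr 1; ext i; simp

/-- Split off a prescribed number of coordinates. -/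
lemma exists_equiv_sum (κ : Type*) [Fintype κ] (ι : Type*) [Fintype ι] {n : ℕ}
    (h : Fintype.card κ + n ≤ Fintype.card ι) : ∃ n', n ≤ n' ∧ Nonempty (ι ≃ κ ⊕ Fin n') :=
  ⟨Fintype.card ι - Fintype.card κ, by omega, ⟨Fintype.equivOfCardEq (by simp; omega)⟩⟩

end Words

/-- The density Hales-Jewett property of an alphabet. -/
def DensityHalesJewett (κ : Type) [Fintype κ] : Prop :=
  ∀ δ : ℝ, 0 < δ → ∃ n : ℕ, ∀ (ι : Type) [Fintype ι] [DecidableEq ι], n ≤ Fintype.card ι →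
    ∀ A : Set (ι → κ), δ ≤ density A → ∃ l : Line κ ι, ∀ x, l x ∈ A

section Subspaces

variable {η η' α ι ι' κ : Type*}

/-- The composition of two combinatorial subspaces. -/
def Combinatorics.Subspace.comp (V : Subspace η α ι) (W : Subspace η' α η) : Subspace η' α ι where
  idxFun i := (V.idxFun i).elim Sum.inl W.idxFun
  proper e := by
    obtain ⟨j, hj⟩ := W.proper e
    obtain ⟨i, hi⟩ := V.proper j
    exact ⟨i, by simp [hi, hj]⟩

lemma Combinatorics.Subspace.comp_apply (V : Subspace η α ι) (W : Subspace η' α η) (x : η' → α) :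
    V.comp W x = V (W x) := by
  funext i
  simp only [Subspace.coe_apply, Subspace.comp]
  cases V.idxFun i <;> simp [Subspace.coe_apply]

/-- Append a constant word to a combinatorial subspace. -/
def Combinatorics.Subspace.horizontal (V : Subspace η α ι) (y : ι' → α) :
    Subspace η α (ι ⊕ ι') where
  idxFun := Sum.elim V.idxFun (Sum.inl ∘ y)
  proper e := let ⟨i, hi⟩ := V.proper e; ⟨Sum.inl i, hi⟩

lemma Combinatorics.Subspace.horizontal_apply (V : Subspace η α ι) (y : ι' → α) (x : η → α) :
    V.horizontal y x = Sum.elim (V x) y := by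
  funext i
  cases i <;> rfl

/-- Prepend a constant word to a combinatorial subspace. -/
def Combinatorics.Subspace.vertical (s : ι → α) (V : Subspace η α ι') :
    Subspace η α (ι ⊕ ι') where
  idxFun := Sum.elim (Sum.inl ∘ s) V.idxFun
  proper e := let ⟨i, hi⟩ := V.proper e; ⟨Sum.inr i, hi⟩

lemma Combinatorics.Subspace.vertical_apply (s : ι → α) (V : Subspace η α ι') (x : η → α) :
    V.vertical s x = Sum.elim s (V x) := by
  funext i
  cases i <;> rfl

lemma Combinatorics.Subspace.injective (V : Subspace η α ι) : Function.Injective V := by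
  intro x y h
  funext e
  obtain ⟨i, hi⟩ := V.proper e
  simpa [Subspace.coe_apply, hi] using congrFun h i

/-- The image of a combinatorial line under a combinatorial subspace. -/
def Combinatorics.Subspace.compLine (V : Subspace η α ι) (l : Line α η) : Line α ι where
  idxFun i := (V.idxFun i).elim some l.idxFun
  proper := by
    obtain ⟨j, hj⟩ := l.proper
    obtain ⟨i, hi⟩ := V.proper j
    exact ⟨i, by simp [hi, hj]⟩

lemma Combinatorics.Subspace.compLine_apply (V : Subspace η α ι) (l : Line α η) (x : α) :
    V.compLine l x = V (l x) := by
  funext i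
  simp only [Subspace.coe_apply, Subspace.compLine, Line.coe_apply]
  cases V.idxFun i <;> simp

/-- Relabel the coordinates of a combinatorial line. -/
def Combinatorics.Line.relabel (l : Line α ι) (e : ι' ≃ ι) : Line α ι' where
  idxFun i := l.idxFun (e i)
  proper := let ⟨j, hj⟩ := l.proper; ⟨e.symm j, by simpa using hj⟩

lemma Combinatorics.Line.relabel_apply (l : Line α ι) (e : ι' ≃ ι) (x : α) :
    l.relabel e x = l x ∘ e := rfl

/-- Relabel the coordinates of a combinatorial subspace. -/
def Combinatorics.Subspace.relabel (V : Subspace η α ι) (e : ι' ≃ ι) : Subspace η α ι' where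
  idxFun i := V.idxFun (e i)
  proper j := let ⟨i, hi⟩ := V.proper j; ⟨e.symm i, by simpa using hi⟩

lemma Combinatorics.Subspace.relabel_apply (V : Subspace η α ι) (e : ι' ≃ ι) (x : η → α) :
    V.relabel e x = V x ∘ e := rfl

/-- Join a combinatorial line to a combinatorial subspace; the direction of the line is `0`. -/
def Combinatorics.Line.joinSubspace {d : ℕ} (l : Line α ι) (V : Subspace (Fin d) α ι') :
    Subspace (Fin (d + 1)) α (ι ⊕ ι') where
  idxFun := Sum.elim (fun i => (l.idxFun i).elim (Sum.inr 0) Sum.inl)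
    (fun i => (V.idxFun i).map id Fin.succ)
  proper e := by
    refine Fin.cases ?_ (fun e => ?_) e
    · exact l.proper.elim fun i hi => ⟨Sum.inl i, by simp [hi]⟩
    · exact (V.proper e).elim fun i hi => ⟨Sum.inr i, by simp [hi]⟩

lemma Combinatorics.Line.joinSubspace_apply {d : ℕ} (l : Line α ι) (V : Subspace (Fin d) α ι')
    (x : Fin (d + 1) → α) :
    l.joinSubspace V x = Sum.elim (l (x 0)) (V (x ∘ Fin.succ)) := by
  funext i
  rcases i with i | i
  · simp only [Subspace.coe_apply, Line.joinSubspace, Sum.elim_inl, Line.coe_apply]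
    cases l.idxFun i <;> simp
  · simp only [Subspace.coe_apply, Line.joinSubspace, Sum.elim_inr]
    cases V.idxFun i <;> simp

end Subspaces

/-! ### Multidimensional density Hales-Jewett -/

/-- The multidimensional form of the density Hales-Jewett property. -/
lemma DensityHalesJewett.exists_subspace {κ : Type} [Fintype κ] (h : DensityHalesJewett κ)
    (d : ℕ) : ∀ δ : ℝ, 0 < δ → ∃ n : ℕ, ∀ (ι : Type) [Fintype ι] [DecidableEq ι],
      n ≤ Fintype.card ι → ∀ A : Set (ι → κ), δ ≤ density A →
        ∃ V : Subspace (Fin d) κ ι, ∀ x, V x ∈ A := by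
  classical
  induction d with
  | zero =>
    refine fun δ hδ => ⟨0, fun ι _ _ _ A hA => ?_⟩
    obtain ⟨z, hz⟩ := nonempty_of_density_pos (hδ.trans_le hA)
    exact ⟨⟨fun i => Sum.inl (z i), fun e => e.elim0⟩, fun x => hz⟩
  | succ d ih =>
    intro δ hδ
    obtain ⟨m, hm⟩ := h (δ / 2) (by positivity)
    have hK : (0 : ℝ) < Fintype.card (Fin m → Option κ) := by
      exact_mod_cast Fintype.card_pos
    obtain ⟨n, hn⟩ := ih (δ / 2 / Fintype.card (Fin m → Option κ)) (by positivity)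
    refine ⟨m + n, fun ι _ _ hι A hA => ?_⟩
    obtain ⟨n', hn', ⟨e⟩⟩ := exists_equiv_sum (Fin m) ι (n := n) (by simpa using hι)
    rw [density, expect_comp_equiv e, expect_sum_arrow_comm] at hA
    have : Nonempty (Fin n' → κ) := by
      by_contra hne
      rw [not_nonempty_iff] at hne
      simp at hA
      linarith
    have hgood := half_le_density_half_le hδ.le (fun y => density_le_one
      {s : Fin m → κ | (Sum.elim s y) ∘ e ∈ A}) hA
    -- Every `y` with a dense fibre has a line in that fibre. Pigeonholing over line templates gives
    -- one line for a dense set of `y`, in which the induction finds a d-dimensional subspace.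
    obtain ⟨q, hq⟩ := exists_density_ge
      (A := {y : Fin n' → κ | δ / 2 ≤ density {s : Fin m → κ | Sum.elim s y ∘ e ∈ A}})
      (fun q : Fin m → Option κ => {y : Fin n' → κ | ∃ l : Line κ (Fin m), l.idxFun = q ∧
        ∀ x, Sum.elim (l x) y ∘ e ∈ A}) (fun y hy => by
          obtain ⟨l, hl⟩ := hm (Fin m) (by simp) _ hy
          exact Set.mem_iUnion.2 ⟨l.idxFun, l, rfl, hl⟩)
    obtain ⟨V, hV⟩ := hn (Fin n') (by simpa using hn') _ (le_trans (by gcongr) hq)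
    rcases (isEmpty_or_nonempty (Fin d → κ)).symm with ⟨⟨x₀⟩⟩ | hem
    · obtain ⟨l, rfl, -⟩ := hV x₀
      refine ⟨(l.joinSubspace V).relabel e, fun x => ?_⟩
      obtain ⟨l', h1, h2⟩ := hV (x ∘ Fin.succ)
      obtain rfl : l' = l := Line.ext h1
      rw [Subspace.relabel_apply, Line.joinSubspace_apply]
      exact h2 _
    -- Degenerate case: the alphabet is empty, so `V` has no points and any line will do.
    · obtain ⟨y⟩ := ‹Nonempty (Fin n' → κ)›
      have : IsEmpty κ := by
        by_contra hne
        rw [not_isEmpty_iff] at hne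
        exact hem.elim fun _ => hne.some
      obtain ⟨y, hy⟩ := nonempty_of_density_pos (A := {y : Fin n' → κ |
        δ / 2 ≤ density {s : Fin m → κ | Sum.elim s y ∘ e ∈ A}}) (by linarith)
      obtain ⟨l, -⟩ := hm (Fin m) (by simp) _ hy
      exact ⟨(l.joinSubspace V).relabel e, fun x => (this.false (x 0)).elim⟩

lemma density_pi {ι α : Type*} [Fintype ι] [DecidableEq ι] [Fintype α] (T : ι → Finset α) :
    density {z : ι → α | ∀ b, z b ∈ T b} = ∏ b, ((T b).card / Fintype.card α : ℝ) := by
  classical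
  have : {z : ι → α | ∀ b, z b ∈ T b} = (Fintype.piFinset T : Set (ι → α)) := by
    ext z; simp
  rw [this, density_eq_ncard, Set.ncard_coe_finset, Fintype.card_piFinset, Fintype.card_pi,
    Finset.prod_div_distrib]
  push_cast
  rfl

lemma density_forall_mem {ι α : Type*} [Fintype ι] [DecidableEq ι] [Fintype α] (s : Finset ι)
    [Nonempty α] (a : α) :
    density {z : ι → α | ∀ b ∈ s, z b = a} = (1 / Fintype.card α : ℝ) ^ s.card := by
  classical
  have : {z : ι → α | ∀ b ∈ s, z b = a} =
      {z | ∀ b, z b ∈ if b ∈ s then ({a} : Finset α) else Finset.univ} := by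
    ext z
    refine forall_congr' fun b => ?_
    by_cases hb : b ∈ s <;> simp [hb]
  rw [this, density_pi, ← Finset.prod_subset (Finset.subset_univ s), Finset.prod_congr rfl,
    Finset.prod_const]
  · intro b hb
    simp [hb]
  · intro b _ hb
    simp [hb]

/-! ### Sets that do not distinguish `none` from another letter -/

section Collapse

variable {κ : Type} {ι ι' η : Type*}

/-- Replace the letter `none` of a word by the letter `i`. -/
def collapse (i : κ) (z : ι → Option κ) : ι → κ := fun b => (z b).getD i

lemma collapse_sum_elim_comp {ι'' : Type*} (i : κ) (s : ι → Option κ) (y : ι' → Option κ)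
    (e : ι'' → ι ⊕ ι') :
    collapse i (Sum.elim s y ∘ e) = Sum.elim (collapse i s) (collapse i y) ∘ e := by
  funext b
  simp only [collapse, Function.comp]
  cases e b <;> rfl

/-- Rerandomize the letters of a word which differ from `none`. -/
def rerandomize (κ : Type) (ι : Type*) :
    ((ι → Option κ) × (ι → κ)) ≃ ((ι → Option κ) × (ι → κ)) :=
  -- Exchanges the two letters at each position where the first word is not `none`, so the uniform
  -- measure is preserved.
  Function.Involutive.toPerm
    (fun p => (fun b => (p.1 b).map fun _ => p.2 b, fun b => (p.1 b).getD (p.2 b))) (by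
      rintro ⟨z, x⟩
      refine Prod.ext ?_ ?_ <;> funext b <;> cases h : z b <;> simp [h])

lemma rerandomize_fst_apply (p : (ι → Option κ) × (ι → κ)) (b : ι) :
    (rerandomize κ ι p).1 b = (p.1 b).map fun _ => p.2 b := rfl

/-- Extend a subspace over the alphabet `κ` to a subspace over `Option κ`, using the letter `none`
outside the set `R`. -/
def Combinatorics.Subspace.extendNone {R : ι → Prop} [DecidablePred R]
    (W : Subspace η κ {b // R b}) : Subspace η (Option κ) ι where
  idxFun b := if h : R b then (W.idxFun ⟨b, h⟩).map some id else Sum.inl none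
  proper e := let ⟨b, hb⟩ := W.proper e; ⟨b, by simp [b.2, hb]⟩

lemma Combinatorics.Subspace.collapse_extendNone {R : ι → Prop} [DecidablePred R]
    (W : Subspace η κ {b // R b}) (i : κ) (u : η → Option κ) (b : ι) :
    collapse i (W.extendNone u) b = if h : R b then W (collapse i u) ⟨b, h⟩ else i := by
  simp only [collapse, Subspace.coe_apply, Subspace.extendNone]
  by_cases h : R b
  · simp only [h, dite_true]
    cases W.idxFun ⟨b, h⟩ <;> simp [collapse]
  · simp [h]

end Collapse

/-- A dense set of words over `Option κ` which does not distinguish `none` from `i` contains a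
subspace of prescribed dimension. -/
lemma DensityHalesJewett.exists_subspace_collapse {κ : Type} [Fintype κ]
    (h : DensityHalesJewett κ) (i : κ) (d : ℕ) {β : ℝ} (hβ : 0 < β) :
    ∃ (B : Type) (_ : Fintype B) (_ : DecidableEq B), ∀ F : Set (B → κ),
      β ≤ density {z : B → Option κ | collapse i z ∈ F} →
        ∃ V : Subspace (Fin d) (Option κ) B, ∀ u, collapse i (V u) ∈ F := by
  classical
  obtain ⟨m, hm⟩ := h.exists_subspace d (β / 2) (by positivity)
  have hκ : Nonempty κ := ⟨i⟩
  have hK : (1 / Fintype.card (Option κ) : ℝ) < 1 := by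
    rw [div_lt_one (by exact_mod_cast Fintype.card_pos)]
    rw [Fintype.card_option]
    exact_mod_cast Nat.lt_add_of_pos_left Fintype.card_pos
  -- A collapsed uniform word is biased towards `i`, so the theorem for κ does not apply directly.
  -- It is applied only on the positions different from `none`, where the letters are uniform in κ.
  -- At least `m` of these are needed: with `m` rows of length `L`, some row is entirely `none` only
  -- with probability at most β / 2.
  obtain ⟨L, hL⟩ := exists_pow_lt_of_lt_one (show 0 < β / 2 / (m + 1) by positivity) hK
  refine ⟨Fin m × Fin L, inferInstance, inferInstance, fun F hF => ?_⟩
  set E : Set (Fin m × Fin L → Option κ) := {z | collapse i z ∈ F} with hE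
  set G : Set (Fin m × Fin L → Option κ) := ⋃ j : Fin m, {z | ∀ c, z (j, c) = none} with hG
  have hGd : density G ≤ β / 2 := by
    refine (density_iUnion_le _).trans ?_
    calc ∑ j : Fin m, density {z : Fin m × Fin L → Option κ | ∀ c, z (j, c) = none}
        = ∑ j : Fin m, (1 / Fintype.card (Option κ) : ℝ) ^ L := by
          refine Finset.sum_congr rfl fun j _ => ?_
          have : {z : Fin m × Fin L → Option κ | ∀ c, z (j, c) = none} =
              {z | ∀ b ∈ ({j} : Finset (Fin m)) ×ˢ (Finset.univ : Finset (Fin L)),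
                z b = none} := by
            ext z; simp
          rw [this, density_forall_mem]
          simp
      _ ≤ m * (β / 2 / (m + 1)) := by
          rw [Finset.sum_const, nsmul_eq_mul, Finset.card_univ, Fintype.card_fin]
          gcongr
      _ ≤ β / 2 := by
          rw [mul_div_assoc', div_le_iff₀ (by positivity)]
          nlinarith
  have hEG : β / 2 ≤ density (E \ G) := by
    have h1 := density_inter_add_diff E G
    have h2 := density_mono (Set.inter_subset_right : E ∩ G ⊆ G)
    linarith
  have h3 : density (E \ G) = 𝔼 z : Fin m × Fin L → Option κ,
      density {x : Fin m × Fin L → κ | (rerandomize κ _ (z, x)).1 ∈ E \ G} := by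
    refine Eq.trans ?_ (density_prod (X := Fin m × Fin L → Option κ) (Y := Fin m × Fin L → κ)
      {p | (rerandomize κ _ p).1 ∈ E \ G})
    rw [← density_preimage_equiv (rerandomize κ (Fin m × Fin L)).symm, density_prod]
    simp only [Set.preimage, Set.mem_ofPred_eq, Equiv.apply_symm_apply]
    refine Finset.expect_congr rfl fun z _ => ?_
    by_cases hz : z ∈ E \ G
    · simpa only [density, Set.indicator, Set.mem_ofPred_eq, if_pos hz] using
        (Fintype.expect_const 1).symm
    · simp only [density, Set.indicator, Set.mem_ofPred_eq, if_neg hz]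
      exact (Fintype.expect_const 0).symm
  rw [h3] at hEG
  obtain ⟨z, hz⟩ := exists_ge_of_le_expect hEG
  have hR : m ≤ Fintype.card {b // z b ≠ none} := by
    obtain ⟨x, -, hx⟩ := nonempty_of_density_pos (lt_of_lt_of_le (by positivity) hz)
    have : ∀ j : Fin m, ∃ c, z (j, c) ≠ none := by
      intro j
      by_contra! hj
      exact hx (Set.mem_iUnion.2 ⟨j, fun c => by simp [rerandomize_fst_apply, hj c]⟩)
    choose c hc using this
    simpa using Fintype.card_le_of_injective (fun j => (⟨(j, c j), hc j⟩ : {b // z b ≠ none}))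
      fun j j' hj => by simpa using congrArg (fun b => b.1.1) hj
  -- Once the pattern of `none` positions is fixed, the word on the remaining ones is uniform over
  -- κ. The letters `y` on the `none` positions play no role in the result.
  let e : Fin m × Fin L ≃ {b // z b ≠ none} ⊕ {b // ¬ z b ≠ none} := (Equiv.sumCompl _).symm
  rw [density, expect_comp_equiv e, expect_sum_arrow_comm] at hz
  obtain ⟨y, hy⟩ := exists_ge_of_le_expect hz
  obtain ⟨W, hW⟩ := hm {b // z b ≠ none} hR
    {s | (rerandomize κ _ (z, Sum.elim s y ∘ e)).1 ∈ E \ G} hy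
  refine ⟨W.extendNone, fun u => ?_⟩
  have h4 : collapse i (rerandomize κ _ (z, Sum.elim (W (collapse i u)) y ∘ e)).1 ∈ F :=
    (hW (collapse i u)).1
  convert h4 using 1
  funext b
  rw [Subspace.collapse_extendNone]
  by_cases hb : z b ≠ none
  · obtain ⟨a, ha⟩ := Option.ne_none_iff_exists'.1 hb
    have heb : e b = Sum.inl ⟨b, hb⟩ := Equiv.sumCompl_symm_apply_of_pos (p := fun b => z b ≠ none) hb
    simp [rerandomize_fst_apply, collapse, ha, heb]
  · simp only [hb, dite_false]
    simp only [ne_eq, not_not] at hb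
    simp [rerandomize_fst_apply, collapse, hb]

/-- Since `V` is injective, both averages have the same numerator; only the normalisation differs.
-/
lemma Combinatorics.Subspace.expect_indicator_range_nonpos {η α ι : Type*} [Fintype η]
    [DecidableEq η] [Fintype ι] [DecidableEq ι] [Fintype α] (V : Subspace η α ι)
    (g : (ι → α) → ℝ) (hg : 𝔼 u, g (V u) ≤ 0) : 𝔼 s, (Set.range V).indicator g s ≤ 0 := by
  classical
  have h0 : ∑ u, g (V u) ≤ 0 := by
    rw [← Fintype.card_mul_expect]
    exact mul_nonpos_of_nonneg_of_nonpos (by positivity) hg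
  have : ∑ s, (Set.range V).indicator g s = ∑ u, g (V u) := by
    rw [Finset.sum_indicator_eq_sum_filter, ← Finset.sum_image (s := Finset.univ) (g := V) (f := g)
      (fun x _ y _ hxy => V.injective hxy)]
    refine Finset.sum_congr ?_ fun _ _ => rfl
    ext s
    simp
  rw [Fintype.expect_eq_sum_div_card, this]
  exact div_nonpos_of_nonpos_of_nonneg h0 (by positivity)

set_option maxHeartbeats 1000000 in
/-- Functions with nonpositive averages on all subspaces of a fixed dimension have nearly
nonpositive averages on families of sets which do not distinguish `none` from `i`. -/
lemma DensityHalesJewett.expect_indicator_collapse_le {κ : Type} [Fintype κ]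
    (h : DensityHalesJewett κ) (i : κ) (d : ℕ) {β : ℝ} (hβ : 0 < β) :
    ∃ n : ℕ, ∀ (ι : Type) [Fintype ι] [DecidableEq ι], n ≤ Fintype.card ι →
      ∀ (T : Type) [Fintype T] (F : T → Set (ι → κ)) (f : T → (ι → Option κ) → ℝ),
        (∀ t z, f t z ≤ 1) →
        (∀ t (V : Subspace (Fin d) (Option κ) ι), 𝔼 u, f t (V u) ≤ 0) →
        𝔼 t, 𝔼 z, {z | collapse i z ∈ F t}.indicator (f t) z ≤ β := by
  classical
  obtain ⟨B, _, _, hB⟩ := h.exists_subspace_collapse i d (half_pos hβ)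
  -- The density gained per round: a proportion β / 2 of fibres are dense, and each of them loses at
  -- least one point.
  set c : ℝ := β / 2 * (1 / Fintype.card (B → Option κ)) with hc
  have hK : (0 : ℝ) < Fintype.card (B → Option κ) := by exact_mod_cast Fintype.card_pos
  have hc0 : 0 < c := by positivity
  have key : ∀ r : ℕ, ∀ (ι : Type) [Fintype ι] [DecidableEq ι],
      r * Fintype.card B ≤ Fintype.card ι →
      ∀ (T : Type) [Fintype T] (F : T → Set (ι → κ)) (f : T → (ι → Option κ) → ℝ),
        (∀ t z, f t z ≤ 1) →
        (∀ t (V : Subspace (Fin d) (Option κ) ι), 𝔼 u, f t (V u) ≤ 0) →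
        𝔼 t, 𝔼 z, {z | collapse i z ∈ F t}.indicator (f t) z ≤
          max β (𝔼 t, density {z | collapse i z ∈ F t} - r * c) := by
    have triv : ∀ (ι : Type) [Fintype ι] [DecidableEq ι] (T : Type) [Fintype T]
        (F : T → Set (ι → κ)) (f : T → (ι → Option κ) → ℝ), (∀ t z, f t z ≤ 1) →
        𝔼 t, 𝔼 z, {z | collapse i z ∈ F t}.indicator (f t) z ≤
          𝔼 t, density {z | collapse i z ∈ F t} := by
      intro ι _ _ T _ F f hf
      exact expect_mono fun t => expect_mono fun z => Set.indicator_le_indicator (hf t z)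
    intro r
    induction r with
    | zero =>
      intro ι _ _ _ T _ F f hf _
      exact (triv ι T F f hf).trans (le_max_of_le_right (by simp))
    | succ r ih =>
      intro ι _ _ hι T _ F f hf hV
      by_cases hden : 𝔼 t, density {z | collapse i z ∈ F t} ≤ β
      · exact (triv ι T F f hf).trans (le_max_of_le_left hden)
      push Not at hden
      obtain ⟨n', hn', ⟨e⟩⟩ := exists_equiv_sum B ι (n := r * Fintype.card B)
        (by rw [add_comm, ← Nat.succ_mul]; exact hι)
      let good : T → (Fin n' → κ) → Prop := fun t x =>
        ∃ V : Subspace (Fin d) (Option κ) B, ∀ u, Sum.elim (collapse i (V u)) x ∘ e ∈ F t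
      -- The removed subspace is chosen from the collapsed word `x` alone. Hence, for fixed `s`,
      -- what is left is still a condition on `collapse i y`; adjoining `s` to the index type allows
      -- the next round. This is why a family over `T` is needed.
      let Rem : T → (Fin n' → κ) → Set (B → Option κ) := fun t x =>
        {s | ∃ hg : good t x, s ∈ Set.range hg.choose}
      let E : T → (Fin n' → κ) → Set (B → Option κ) := fun t x =>
        {s | Sum.elim (collapse i s) x ∘ e ∈ F t}
      have hRE : ∀ t x, Rem t x ⊆ E t x := by
        rintro t x _ ⟨hg, u, rfl⟩
        exact hg.choose_spec u
      have ih' := ih (Fin n') (by simpa using hn') (T × (B → Option κ))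
        (fun p => {x | p.2 ∈ E p.1 x \ Rem p.1 x}) (fun p y => f p.1 (Sum.elim p.2 y ∘ e))
        (fun p y => hf _ _) (fun p V => by
          have := hV p.1 ((V.vertical p.2).relabel e)
          simpa only [Subspace.relabel_apply, Subspace.vertical_apply] using this)
      rw [expect_prod, expect_prod] at ih'
      have e1 : 𝔼 t, 𝔼 z, {z | collapse i z ∈ F t}.indicator (f t) z ≤
          𝔼 t, 𝔼 s, 𝔼 y, {y | collapse i y ∈ {x | s ∈ E t x \ Rem t x}}.indicator
            (fun y => f t (Sum.elim s y ∘ e)) y := by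
        refine expect_mono fun t => ?_
        rw [expect_comp_equiv e, expect_sum_arrow_comm, Finset.expect_comm (s := Finset.univ)
          (t := Finset.univ) (f := fun (s : B → Option κ) (y : Fin n' → Option κ) =>
            {y | collapse i y ∈ {x | s ∈ E t x \ Rem t x}}.indicator
            (fun y => f t (Sum.elim s y ∘ e)) y)]
        refine expect_mono fun y => ?_
        -- The removed part is empty or a subspace, where `f` has nonpositive average; discarding it
        -- can only increase the total.
        have h5 : 𝔼 s, (Rem t (collapse i y)).indicator (fun s => f t (Sum.elim s y ∘ e)) s ≤ 0 := by
          by_cases hg : good t (collapse i y)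
          · have h6 : Rem t (collapse i y) = Set.range hg.choose := by
              ext s; exact ⟨fun ⟨_, hs⟩ => hs, fun hs => ⟨hg, hs⟩⟩
            rw [h6]
            refine hg.choose.expect_indicator_range_nonpos _ ?_
            have := hV t ((hg.choose.horizontal y).relabel e)
            simpa only [Subspace.relabel_apply, Subspace.horizontal_apply] using this
          · have h6 : Rem t (collapse i y) = ∅ := by
              ext s; exact ⟨fun ⟨hs, _⟩ => hg hs, fun hs => hs.elim⟩
            simp [h6]
        refine le_of_eq_of_le ?_ (add_le_of_nonpos_left h5)
        rw [← Finset.expect_add_distrib]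
        refine Finset.expect_congr rfl fun s _ => ?_
        have h7 : collapse i (Sum.elim s y ∘ e) ∈ F t ↔ s ∈ E t (collapse i y) := by
          rw [collapse_sum_elim_comp]; rfl
        have h8 := @hRE t (collapse i y) s
        simp only [Set.indicator, Set.mem_ofPred_eq, h7, Set.mem_sdiff]
        by_cases h10 : s ∈ Rem t (collapse i y)
        · simp only [h10, h8 h10, if_true, not_true, and_false, if_false, add_zero]
        · simp only [h10, not_false_eq_true, and_true, if_false, zero_add]
      have e2 : 𝔼 t, density {z | collapse i z ∈ F t} =
          𝔼 p : T × (Fin n' → Option κ), density (E p.1 (collapse i p.2)) := by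
        rw [expect_prod]
        refine Finset.expect_congr rfl fun t _ => ?_
        rw [density, expect_comp_equiv e, expect_sum_arrow_comm]
        refine Finset.expect_congr rfl fun y _ => Finset.expect_congr rfl fun s _ => ?_
        simp only [Set.indicator, Set.mem_ofPred_eq, collapse_sum_elim_comp]
        rfl
      have e3 : 𝔼 t, 𝔼 s, density {y : Fin n' → Option κ |
            collapse i y ∈ {x | s ∈ E t x \ Rem t x}} =
          𝔼 p : T × (Fin n' → Option κ),
            density (E p.1 (collapse i p.2) \ Rem p.1 (collapse i p.2)) := by
        rw [expect_prod]
        exact Finset.expect_congr rfl fun t _ => Finset.expect_comm _ _ _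
      have e4 : c ≤ 𝔼 p : T × (Fin n' → Option κ), density (Rem p.1 (collapse i p.2)) := by
        have hne : Nonempty (T × (Fin n' → Option κ)) := by
          by_contra hne
          rw [not_nonempty_iff] at hne
          rw [e2] at hden
          simp at hden
          linarith
        have h11 := half_le_density_half_le hβ.le (fun p : T × (Fin n' → Option κ) =>
          density_le_one (E p.1 (collapse i p.2))) (e2 ▸ hden.le)
        rw [hc]
        refine (mul_le_mul_of_nonneg_right h11 (by positivity)).trans ?_
        rw [density, Finset.expect_mul]
        refine expect_mono fun p => ?_
        by_cases hp : β / 2 ≤ density (E p.1 (collapse i p.2))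
        · simp only [Set.indicator, Set.mem_ofPred_eq, hp, if_true, one_mul]
          have hg : good p.1 (collapse i p.2) :=
            hB {w | Sum.elim w (collapse i p.2) ∘ e ∈ F p.1} hp
          exact one_div_card_le_density ⟨_, hg, Set.mem_range_self fun _ => none⟩
        · simp only [Set.indicator, Set.mem_ofPred_eq, hp, if_false, zero_mul]
          exact density_nonneg _
      have e5 : 𝔼 p : T × (Fin n' → Option κ), density (E p.1 (collapse i p.2)) =
          𝔼 p : T × (Fin n' → Option κ), density (Rem p.1 (collapse i p.2)) +
          𝔼 p : T × (Fin n' → Option κ),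
            density (E p.1 (collapse i p.2) \ Rem p.1 (collapse i p.2)) := by
        rw [← Finset.expect_add_distrib]
        refine Finset.expect_congr rfl fun p _ => ?_
        rw [← density_inter_add_diff (E p.1 (collapse i p.2)) (Rem p.1 (collapse i p.2)),
          Set.inter_eq_right.2 (hRE _ _)]
      refine e1.trans (ih'.trans (max_le_max le_rfl ?_))
      rw [e3, e2, e5]
      push_cast
      linarith
  obtain ⟨r, hr⟩ := exists_nat_ge (1 / c)
  refine ⟨r * Fintype.card B, fun ι _ _ hι T _ F f hf hV => (key r ι hι T F f hf hV).trans
    (max_le le_rfl ?_)⟩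
  have h1 : 𝔼 t, density {z | collapse i z ∈ F t} ≤ 1 := by
    rcases isEmpty_or_nonempty T with hT | hT
    · simp
    · exact Finset.expect_le Finset.univ_nonempty fun t _ => density_le_one _
  rw [div_le_iff₀ hc0] at hr
  linarith

lemma Combinatorics.Subspace.collapse_apply {κ : Type} {η ι : Type*} (V : Subspace η (Option κ) ι) (i : κ)
    (u : η → Option κ) :
    collapse i (V u) = fun b => (V.idxFun b).elim (fun a => a.getD i) (collapse i u) := by
  funext b
  simp only [collapse, Subspace.coe_apply]
  cases V.idxFun b <;> simp [collapse]

/-- Functions with nonpositive averages on all subspaces of a fixed dimension have nearly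
nonpositive averages on intersections of sets, each of which does not distinguish `none` from one
of the other letters. -/
lemma DensityHalesJewett.expect_indicator_forall_collapse_le {κ : Type} [Fintype κ] [Nonempty κ]
    (h : DensityHalesJewett κ) (I : Finset κ) : ∀ (d : ℕ) (β : ℝ), 0 < β →
    ∃ n : ℕ, ∀ (ι : Type) [Fintype ι] [DecidableEq ι], n ≤ Fintype.card ι →
      ∀ (F : κ → Set (ι → κ)) (f : (ι → Option κ) → ℝ), (∀ z, f z ≤ 1) →
        (∀ V : Subspace (Fin d) (Option κ) ι, 𝔼 u, f (V u) ≤ 0) →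
        𝔼 z, {z | ∀ i ∈ I, collapse i z ∈ F i}.indicator f z ≤ β := by
  classical
  induction I using Finset.induction_on with
  | empty =>
    intro d β hβ
    obtain ⟨n, hn⟩ := h.expect_indicator_collapse_le (Classical.arbitrary κ) d hβ
    refine ⟨n, fun ι _ _ hι F f hf hV => ?_⟩
    simpa using hn ι hι Unit (fun _ => Set.univ) (fun _ => f) (fun _ => hf) fun _ => hV
  | insert i I hi ih =>
    intro d β hβ
    obtain ⟨m, hm⟩ := ih d (β / 2) (half_pos hβ)
    obtain ⟨n, hn⟩ := h.expect_indicator_collapse_le i m (half_pos hβ)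
    refine ⟨n, fun ι _ _ hι F f hf hV => ?_⟩
    -- By induction, restricting `f` to the sets for `I` gives averages at most β / 2 on
    -- `m`-dimensional subspaces. Subtracting β / 2 makes them nonpositive, so the one-set case
    -- applies in dimension `m`.
    have h1 := hn ι hι Unit (fun _ => F i)
      (fun _ z => {z | ∀ j ∈ I, collapse j z ∈ F j}.indicator f z - β / 2)
      (fun _ z => by
        have : {z | ∀ j ∈ I, collapse j z ∈ F j}.indicator f z ≤ 1 :=
          Set.indicator_apply_le' (fun _ => hf z) fun _ => zero_le_one
        linarith)
      (fun _ V => by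
        rw [Finset.expect_sub_distrib, Fintype.expect_const, sub_nonpos]
        have h2 := hm (Fin m) (by simp) (fun j => {x | (fun b => (V.idxFun b).elim
          (fun a => a.getD j) x) ∈ F j}) (fun u => f (V u)) (fun u => hf _) (fun W => by
            simpa only [Subspace.comp_apply] using hV (V.comp W))
        refine le_of_eq_of_le (Finset.expect_congr rfl fun u _ => ?_) h2
        simp only [Set.indicator, Set.mem_ofPred_eq, V.collapse_apply])
    simp only [Fintype.expect_const] at h1
    have h3 : 𝔼 z, {z | ∀ j ∈ insert i I, collapse j z ∈ F j}.indicator f z ≤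
        𝔼 z, ({z | collapse i z ∈ F i}.indicator
          (fun z => {z | ∀ j ∈ I, collapse j z ∈ F j}.indicator f z - β / 2) z + β / 2) := by
      refine expect_mono fun z => ?_
      by_cases hz : collapse i z ∈ F i
      · simp only [Set.indicator, Set.mem_ofPred_eq, Finset.mem_insert, forall_eq_or_imp, hz,
          true_and, if_true, sub_add_cancel]
        exact le_of_eq (by congr)
      · simp only [Set.indicator, Set.mem_ofPred_eq, Finset.mem_insert, forall_eq_or_imp, hz,
          false_and, if_false]
        linarith
    rw [Finset.expect_add_distrib, Fintype.expect_const] at h3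
    linarith

/-! ### Line-free sets of extremal density -/

/-- A set of words containing no combinatorial line. -/
def LineFree {α ι : Type*} (A : Set (ι → α)) : Prop := ∀ l : Line α ι, ∃ x, l x ∉ A

lemma LineFree.preimage_subspace {α ι η : Type*} {A : Set (ι → α)} (hA : LineFree A)
    (V : Subspace η α ι) : LineFree {u | V u ∈ A} := fun l => by
  obtain ⟨x, hx⟩ := hA (V.compLine l)
  exact ⟨x, by rwa [Subspace.compLine_apply] at hx⟩

lemma LineFree.section_right {α ι B ι' : Type*} {A : Set (ι → α)} (hA : LineFree A)
    (e : ι ≃ B ⊕ ι') (t : B → α) : LineFree {y | Sum.elim t y ∘ e ∈ A} := fun l => by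
  obtain ⟨x, hx⟩ := hA ((l.vertical t).relabel e)
  exact ⟨x, by rwa [Line.relabel_apply, Line.vertical_apply] at hx⟩

lemma LineFree.section_left {α ι B ι' : Type*} {A : Set (ι → α)} (hA : LineFree A)
    (e : ι ≃ B ⊕ ι') (y : ι' → α) : LineFree {t | Sum.elim t y ∘ e ∈ A} := fun l => by
  obtain ⟨x, hx⟩ := hA ((l.horizontal y).relabel e)
  exact ⟨x, by rwa [Line.relabel_apply, Line.horizontal_apply] at hx⟩

/-- If the density Hales-Jewett theorem fails, there is a positive limiting density of line free
sets. -/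
lemma exists_limit_density {α : Type} [Fintype α] (h : ¬ DensityHalesJewett α) :
    ∃ δ : ℝ, 0 < δ ∧ δ ≤ 1 ∧
      (∀ η : ℝ, 0 < η → ∃ n : ℕ, ∀ (ι : Type) [Fintype ι] [DecidableEq ι], n ≤ Fintype.card ι →
        ∀ A : Set (ι → α), LineFree A → density A ≤ δ + η) ∧
      ∀ ε : ℝ, 0 < ε → ∀ n : ℕ, ∃ (ι : Type) (_ : Fintype ι) (_ : DecidableEq ι),
        n ≤ Fintype.card ι ∧ ∃ A : Set (ι → α), LineFree A ∧ δ - ε < density A := by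
  unfold DensityHalesJewett at h
  push Not at h
  obtain ⟨δ₀, hδ₀, h⟩ := h
  let S : Set ℝ := {δ | ∃ n : ℕ, ∀ (ι : Type) [Fintype ι] [DecidableEq ι], n ≤ Fintype.card ι →
        ∀ A : Set (ι → α), LineFree A → density A ≤ δ}
  have h1 : (1 : ℝ) ∈ S := ⟨0, fun ι _ _ _ A _ => density_le_one A⟩
  have hlow : ∀ s ∈ S, δ₀ ≤ s := by
    rintro s ⟨n, hn⟩
    obtain ⟨ι, _, _, hι, A, hA, hl⟩ := h n
    exact hA.trans (hn ι hι A hl)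
  refine ⟨sInf S, hδ₀.trans_le (le_csInf ⟨1, h1⟩ hlow), csInf_le ⟨δ₀, hlow⟩ h1, ?_, ?_⟩
  · intro η hη
    obtain ⟨s, ⟨n, hn⟩, hs⟩ := exists_lt_of_csInf_lt ⟨1, h1⟩ (lt_add_of_pos_right (sInf S) hη)
    exact ⟨n, fun ι _ _ hι A hA => (hn ι hι A hA).trans hs.le⟩
  · intro ε hε n
    by_contra! hcon
    have : sInf S - ε ∈ S := ⟨n, fun ι _ _ hι A hA => hcon ι _ _ hι A hA⟩
    have := csInf_le ⟨δ₀, hlow⟩ this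
    linarith

/-- The deficits `a + ε - g x` are nonnegative and have average at most 2ε, so each is bounded by
their total. -/
lemma le_of_expect_ge_of_le {X : Type*} [Fintype X] {g : X → ℝ} {a ε : ℝ}
    (hg : ∀ x, g x ≤ a + ε) (h : a - ε ≤ 𝔼 x, g x) (x : X) :
    a + ε - 2 * Fintype.card X * ε ≤ g x := by
  have hX : Nonempty X := ⟨x⟩
  have h1 : ∑ x, (a + ε - g x) ≤ Fintype.card X * (2 * ε) := by
    rw [← Fintype.card_mul_expect, Finset.expect_sub_distrib, Fintype.expect_const]
    gcongr
    linarith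
  have h2 := Finset.single_le_sum (f := fun x => a + ε - g x) (s := Finset.univ)
    (fun x _ => sub_nonneg.2 (hg x)) (Finset.mem_univ x)
  linarith

/-- The upper bound for the density of a set `C` which meets an intersection of sets not
distinguishing `none` from one of the other letters only in words without the letter `none`. -/
lemma density_le_of_meets_rarely {κ ι : Type} [Fintype κ] [Nonempty κ] [Fintype ι] [DecidableEq ι]
    {a β : ℝ} (hβ₀ : 0 ≤ β) {C : Set (ι → Option κ)} {F : κ → Set (ι → κ)}
    (hCF : ∀ z ∈ C, (∀ i, collapse i z ∈ F i) → ∀ c, z c ≠ none)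
    (hβ : ∀ F' : κ → Set (ι → κ), 𝔼 z, {z | ∀ i ∈ Finset.univ, collapse i z ∈ F' i}.indicator
      (fun z => C.indicator (fun _ => (1 : ℝ)) z - a) z ≤ β) :
    density C ≤ density {z : ι → Option κ | ∀ c, z c ≠ none} +
      a * (1 - density {z : ι → Option κ | ∀ i, collapse i z ∈ F i}) +
      Fintype.card (Finset κ) * β := by
  classical
  set f : (ι → Option κ) → ℝ := fun z => C.indicator (fun _ => (1 : ℝ)) z - a with hf
  -- The atoms of the sets `F i`. The atom of `Finset.univ` is `D`; the others partition its
  -- complement, and complementing `F i` keeps it a condition on `collapse i z`.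
  let E : Finset κ → Set (ι → Option κ) := fun P =>
    {z | ∀ i ∈ Finset.univ, collapse i z ∈ if i ∈ P then F i else (F i)ᶜ}
  let D : Set (ι → Option κ) := {z | ∀ i, collapse i z ∈ F i}
  let N : Set (ι → Option κ) := {z | ∀ c, z c ≠ none}
  have hE : ∀ z P, z ∈ E P ↔ P = Finset.univ.filter fun i => collapse i z ∈ F i := by
    intro z P
    simp only [E, Set.mem_ofPred_eq, Finset.ext_iff, Finset.mem_filter, Finset.mem_univ, true_and,
      true_imp_iff]
    refine forall_congr' fun i => ?_
    by_cases hP : i ∈ P <;> simp [hP]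
  have hpt : ∀ z, C.indicator (fun _ => (1 : ℝ)) z ≤ N.indicator (fun _ => (1 : ℝ)) z +
      a * (1 - D.indicator (fun _ => (1 : ℝ)) z) +
      ∑ P ∈ Finset.univ.erase Finset.univ, (E P).indicator f z := by
    intro z
    have hN : 0 ≤ N.indicator (fun _ => (1 : ℝ)) z :=
      Set.indicator_nonneg (fun _ _ => zero_le_one) _
    by_cases hz : z ∈ D
    · have h0 : ∑ P ∈ Finset.univ.erase Finset.univ, (E P).indicator f z = 0 := by
        refine Finset.sum_eq_zero fun P hP => Set.indicator_of_notMem (fun hzP => ?_) _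
        refine (Finset.mem_erase.1 hP).1 (((hE z P).1 hzP).trans ?_)
        exact Finset.filter_true_of_mem fun i _ => hz i
      rw [h0]
      by_cases hC : z ∈ C
      · have : z ∈ N := hCF z hC hz
        simp [hC, hz, this]
      · simpa [hC, hz] using hN
    · have h0 : ∑ P ∈ Finset.univ.erase Finset.univ, (E P).indicator f z = f z := by
        rw [Finset.sum_eq_single_of_mem (Finset.univ.filter fun i => collapse i z ∈ F i)]
        · exact Set.indicator_of_mem ((hE _ _).2 rfl) _
        · refine Finset.mem_erase.2 ⟨fun h => hz fun i => ?_, Finset.mem_univ _⟩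
          have := h ▸ Finset.mem_univ i
          exact (Finset.mem_filter.1 this).2
        · exact fun P _ hP => Set.indicator_of_notMem (fun hzP => hP ((hE z P).1 hzP)) _
      rw [h0, hf]
      simp only [hz, not_false_eq_true, Set.indicator_of_notMem]
      linarith
  have h1 := expect_mono hpt
  rw [Finset.expect_add_distrib, Finset.expect_add_distrib, ← Finset.mul_expect,
    Finset.expect_sub_distrib, Fintype.expect_const, Finset.expect_sum_comm] at h1
  have h2 : ∑ P ∈ Finset.univ.erase Finset.univ, 𝔼 z, (E P).indicator f z ≤
      Fintype.card (Finset κ) * β := by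
    refine (Finset.sum_le_sum (g := fun _ => β) fun P _ => ?_).trans ?_
    · exact hβ fun i => if i ∈ P then F i else (F i)ᶜ
    · rw [Finset.sum_const, nsmul_eq_mul]
      gcongr
      exact Finset.card_le_univ _
  exact h1.trans (add_le_add le_rfl h2)

/-! ### Filling blocks of wildcards along a line -/

section Filling

variable {κ : Type} {J M ι : Type*}

/-- In a word indexed by blocks, replace the letter `none` in each block `j` by `q j`. -/
def fillBlocks (q : J → Option κ) (t : J × M → Option κ) : J × M → Option κ :=
  fun b => (t b).orElse fun _ => q b.1

lemma collapse_fillBlocks (l : Line κ J) (i : κ) (t : J × M → Option κ) :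
    some ∘ collapse i (fillBlocks l.idxFun t) = fillBlocks (some ∘ l i) t := by
  funext b
  simp only [collapse, fillBlocks, Function.comp, Line.coe_apply]
  cases t b <;> simp

/-- A word `z` containing `none` can be read as a line with `none` as wildcard. Its point at `none`
is `z`, and its other points are the collapses of `z`. -/
lemma LineFree.ne_none {A : Set (ι → Option κ)} (hA : LineFree A) {z : ι → Option κ} (hz : z ∈ A)
    (h : ∀ i, some ∘ collapse i z ∈ A) (b : ι) : z b ≠ none := by
  intro hb
  obtain ⟨x, hx⟩ := hA ⟨fun b => (z b).map some, b, by simp [hb]⟩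
  refine hx ?_
  cases x with
  | none =>
    convert hz using 1
    funext c
    simp only [Line.coe_apply]
    cases z c <;> simp
  | some i =>
    convert h i using 1
    funext c
    simp only [Line.coe_apply, collapse, Function.comp]
    cases z c <;> simp

/-- Split off one block. -/
def splitBlock (M : Type*) [DecidableEq J] (j : J) : J × M ≃ M ⊕ {b : J × M // b.1 ≠ j} where
  toFun b := if h : b.1 = j then Sum.inl b.2 else Sum.inr ⟨b, h⟩
  invFun := Sum.elim (fun c => (j, c)) Subtype.val
  left_inv b := by
    by_cases h : b.1 = j
    · simp [← h]
    · simp [h]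
  right_inv b := by
    rcases b with c | ⟨b, hb⟩ <;> simp_all

lemma fillBlocks_splitBlock [DecidableEq J] (q : J → Option κ) (j : J) (z : M → Option κ)
    (w : {b : J × M // b.1 ≠ j} → Option κ) :
    fillBlocks q (Sum.elim z w ∘ splitBlock M j) =
      Sum.elim (fun c => (z c).orElse fun _ => q j)
        (fun b => (w b).orElse fun _ => q b.1.1) ∘ splitBlock M j := by
  funext b
  simp only [fillBlocks, Function.comp]
  by_cases h : b.1 = j
  · have : splitBlock M j b = Sum.inl b.2 := by simp [splitBlock, h]
    simp [this, h]
  · have : splitBlock M j b = Sum.inr ⟨b, h⟩ := by simp [splitBlock, h]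
    simp [this]

end Filling

/-! ### The induction on the alphabet -/

/-- If all fillings of all words have dense fibres, then there is a line all of whose points have
a dense set of fillings in common. -/
lemma exists_line_density_fillBlocks {κ J M Y : Type} [Fintype κ] [Nonempty κ] [Fintype J]
    [DecidableEq J] [Fintype M] [DecidableEq M] [Fintype Y] [Nonempty Y] {δ : ℝ} (hδ : 0 < δ)
    (hJ : ∀ A : Set (J → κ), δ / 2 ≤ density A → ∃ l : Line κ J, ∀ x, l x ∈ A)
    (S : (J × M → Option κ) → Set Y) (hS : ∀ t, δ ≤ density (S t)) :
    ∃ l : Line κ J, δ / 2 / Fintype.card (J → Option κ) ≤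
      density {p : (J × M → Option κ) × Y | ∀ i, p.2 ∈ S (fillBlocks (some ∘ l i) p.1)} := by
  classical
  have h1 : δ ≤ 𝔼 p : (J × M → Option κ) × Y,
      density {x : J → κ | p.2 ∈ S (fillBlocks (some ∘ x) p.1)} := by
    rw [expect_prod]
    have h2 : ∀ t : J × M → Option κ,
        δ ≤ 𝔼 y, density {x : J → κ | y ∈ S (fillBlocks (some ∘ x) t)} := by
      intro t
      simp only [density]
      rw [Finset.expect_comm]
      exact Finset.le_expect Finset.univ_nonempty fun x _ => hS (fillBlocks (some ∘ x) t)
    exact Finset.le_expect Finset.univ_nonempty fun t _ => h2 t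
  have h3 := half_le_density_half_le hδ.le (fun p : (J × M → Option κ) × Y =>
    density_le_one {x : J → κ | p.2 ∈ S (fillBlocks (some ∘ x) p.1)}) h1
  obtain ⟨q, hq⟩ := exists_density_ge
    (A := {p : (J × M → Option κ) × Y |
      δ / 2 ≤ density {x : J → κ | p.2 ∈ S (fillBlocks (some ∘ x) p.1)}})
    (fun q : J → Option κ => {p | ∃ l : Line κ J, l.idxFun = q ∧
      ∀ i, p.2 ∈ S (fillBlocks (some ∘ l i) p.1)}) (fun p hp => by
        obtain ⟨l, hl⟩ := hJ _ hp
        exact Set.mem_iUnion.2 ⟨l.idxFun, l, rfl, hl⟩)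
  have hpos : (0 : ℝ) < Fintype.card (J → Option κ) := by exact_mod_cast Fintype.card_pos
  have h4 := (div_le_div_of_nonneg_right h3 hpos.le).trans hq
  obtain ⟨p, l, rfl, -⟩ := nonempty_of_density_pos (lt_of_lt_of_le (by positivity) h4)
  refine ⟨l, h4.trans (density_mono ?_)⟩
  rintro p ⟨l', h5, h6⟩
  obtain rfl : l' = l := Line.ext h5
  exact h6

lemma exists_density_ne_none_le (κ : Type) [Fintype κ] {ε : ℝ} (hε : 0 < ε) :
    ∃ n, ∀ m, n ≤ m → density {z : Fin m → Option κ | ∀ c, z c ≠ none} ≤ ε := by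
  classical
  set q : ℝ := Fintype.card κ / Fintype.card (Option κ) with hq
  have hq0 : 0 ≤ q := by positivity
  have hq1 : q < 1 := by
    rw [hq, div_lt_one (by exact_mod_cast Fintype.card_pos), Fintype.card_option]
    exact_mod_cast Nat.lt_succ_self _
  obtain ⟨n, hn⟩ := exists_pow_lt_of_lt_one hε hq1
  refine ⟨n, fun m hm => le_trans (le_of_eq ?_)
    ((pow_le_pow_of_le_one hq0 hq1.le hm).trans hn.le)⟩
  have : {z : Fin m → Option κ | ∀ c, z c ≠ none} =
      {z | ∀ c, z c ∈ (Finset.univ.erase none : Finset (Option κ))} := by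
    ext z; simp
  rw [this, density_pi, Finset.prod_const, Finset.card_univ, Fintype.card_fin,
    Finset.card_erase_of_mem (Finset.mem_univ _), Finset.card_univ, hq, Fintype.card_option]
  simp

set_option maxHeartbeats 1000000 in
theorem DensityHalesJewett.option {κ : Type} [Fintype κ] [Nonempty κ]
    (h : DensityHalesJewett κ) : DensityHalesJewett (Option κ) := by
  classical
  by_contra hcon
  obtain ⟨δ, hδ, hδ1, hup, hlow⟩ := exists_limit_density hcon
  obtain ⟨m₀, hm₀⟩ := h (δ / 2 / 2) (by positivity)
  set θ : ℝ := δ / 2 / 2 / Fintype.card (Fin m₀ → Option κ) with hθ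
  have hcard : (1 : ℝ) ≤ Fintype.card (Fin m₀ → Option κ) := by
    exact_mod_cast Fintype.card_pos
  have hθ0 : 0 < θ := by positivity
  have hθ1 : θ ≤ 1 := by
    rw [hθ, div_le_one (by positivity)]
    linarith
  -- Small enough to contradict δ - γ ≤ 2γ + (δ + γ)(1 - θ), the inequality reached at the end.
  set γ : ℝ := δ * θ / 8 with hγ
  have hγ0 : 0 < γ := by positivity
  have hγδ : γ ≤ δ / 2 := by nlinarith
  obtain ⟨d, hd⟩ := hup γ hγ0
  set β : ℝ := γ / Fintype.card (Finset κ) with hβ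
  have hPcard : (0 : ℝ) < Fintype.card (Finset κ) := by exact_mod_cast Fintype.card_pos
  have hβ0 : 0 < β := by positivity
  obtain ⟨M₁, hM₁⟩ := h.expect_indicator_forall_collapse_le Finset.univ d β hβ0
  obtain ⟨M₂, hM₂⟩ := exists_density_ne_none_le κ hγ0
  obtain ⟨M, hM1, hM2⟩ : ∃ M, M₁ ≤ M ∧ M₂ ≤ M := ⟨max M₁ M₂, le_max_left _ _, le_max_right _ _⟩
  have hBcard : (0 : ℝ) < Fintype.card (Fin m₀ × Fin M → Option κ) := by
    exact_mod_cast Fintype.card_pos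
  set ε : ℝ := γ / (2 * Fintype.card (Fin m₀ × Fin M → Option κ)) with hε
  have hε0 : 0 < ε := by positivity
  obtain ⟨n, hn⟩ := hup ε hε0
  obtain ⟨ι, _, _, hι, A, hA, hAd⟩ := hlow ε hε0 (Fintype.card (Fin m₀ × Fin M) + n)
  obtain ⟨n', hn', ⟨e⟩⟩ := exists_equiv_sum _ _ hι
  let S : (Fin m₀ × Fin M → Option κ) → Set (Fin n' → Option κ) :=
    fun t => {y | Sum.elim t y ∘ e ∈ A}
  -- No section exceeds δ + ε, while their average is at least δ - ε. There are boundedly many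
  -- sections, so none falls below δ - γ.
  have hSlow : ∀ t, δ - γ ≤ density (S t) := by
    intro t
    rw [density, expect_comp_equiv e, expect_sum_arrow] at hAd
    have h1 := le_of_expect_ge_of_le (g := fun t => density (S t))
      (fun t => hn (Fin n') (by simpa using hn') _ (hA.section_right e t)) hAd.le t
    have h2 : 2 * Fintype.card (Fin m₀ × Fin M → Option κ) * ε = γ := by
      rw [hε]; field_simp
    rw [h2] at h1
    linarith
  obtain ⟨l, hl⟩ := exists_line_density_fillBlocks (half_pos hδ) (hm₀ (Fin m₀) (by simp)) S
    (fun t => by linarith [hSlow t])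
  -- Only an active block `j` stays free. Filling along `l.idxFun` leaves its word `z` unchanged,
  -- while filling along `l i` turns it into `collapse i z`; this is what makes the second condition
  -- blind to `none` versus `i`.
  obtain ⟨j, hj⟩ := l.proper
  let e₂ := splitBlock (Fin M) j
  rw [density_prod, expect_comp_equiv e₂, expect_sum_arrow_comm] at hl
  obtain ⟨w, hw⟩ := exists_ge_of_le_expect hl
  have hDw : θ ≤ 𝔼 y, density {z : Fin M → Option κ | ∀ i,
      y ∈ S (fillBlocks (some ∘ l i) (Sum.elim z w ∘ e₂))} := by
    refine hw.trans (le_of_eq ?_)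
    simp only [density]
    rw [Finset.expect_comm]
    rfl
  have hCw : δ - γ ≤ 𝔼 y, density {z : Fin M → Option κ |
      y ∈ S (fillBlocks l.idxFun (Sum.elim z w ∘ e₂))} := by
    simp only [density]
    rw [Finset.expect_comm]
    exact Finset.le_expect Finset.univ_nonempty fun z _ => hSlow _
  have hfill : ∀ z : Fin M → Option κ, fillBlocks l.idxFun (Sum.elim z w ∘ e₂) =
      Sum.elim z (fun b => (w b).orElse fun _ => l.idxFun b.1.1) ∘ e₂ := by
    intro z
    rw [fillBlocks_splitBlock, hj]
    congr 2
    funext c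
    cases z c <;> rfl
  have hfill' : ∀ (z : Fin M → Option κ) i, fillBlocks (some ∘ l i) (Sum.elim z w ∘ e₂) =
      Sum.elim (some ∘ collapse i z) (fun b => (w b).orElse fun _ => some (l i b.1.1)) ∘ e₂ := by
    intro z i
    rw [fillBlocks_splitBlock]
    congr 2
    funext c
    simp only [Function.comp, collapse, Line.coe_apply, hj]
    cases z c <;> rfl
  have hy : ∀ y, density {z : Fin M → Option κ |
      y ∈ S (fillBlocks l.idxFun (Sum.elim z w ∘ e₂))} ≤ γ + (δ + γ) * (1 -
      density {z : Fin M → Option κ | ∀ i,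
        y ∈ S (fillBlocks (some ∘ l i) (Sum.elim z w ∘ e₂))}) + γ := by
    intro y
    have hAy := hA.section_left e y
    set C : Set (Fin M → Option κ) :=
      {z | y ∈ S (fillBlocks l.idxFun (Sum.elim z w ∘ e₂))} with hC
    have hCfree : LineFree C := by
      have := hAy.section_left e₂ (fun b => (w b).orElse fun _ => l.idxFun b.1.1)
      simp only [hC, hfill]
      exact this
    have h1 := density_le_of_meets_rarely (a := δ + γ) (β := β) hβ0.le (C := C)
      (F := fun i => {x | y ∈ S (Sum.elim (some ∘ x)
        (fun b => (w b).orElse fun _ => some (l i b.1.1)) ∘ e₂)})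
      (fun z hz hF c hc => by
        -- If `z` contained `none`, the filled word and its collapses would form a line in the
        -- section of `A` at `y`.
        have h2 := hAy.ne_none (z := fillBlocks l.idxFun (Sum.elim z w ∘ e₂)) hz (fun i => by
          rw [collapse_fillBlocks, hfill']
          exact hF i) (j, c)
        refine h2 ?_
        rw [hfill]
        have : e₂ (j, c) = Sum.inl c := by simp [e₂, splitBlock]
        simp [this, hc])
      (fun F' => hM₁ (Fin M) (by simpa using hM1) F' _ (fun z => by
        have : C.indicator (fun _ => (1 : ℝ)) z ≤ 1 :=
          Set.indicator_apply_le' (fun _ => le_rfl) fun _ => zero_le_one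
        linarith) (fun V => by
        rw [Finset.expect_sub_distrib, Fintype.expect_const, sub_nonpos]
        exact hd (Fin d) (by simp) _ (hCfree.preimage_subspace V)))
    have h3 := hM₂ M hM2
    have h4 : Fintype.card (Finset κ) * β = γ := by
      rw [hβ]; field_simp
    simp only [hfill']
    rw [h4] at h1
    exact h1.trans (by gcongr; exact le_rfl)
  have hfin := hCw.trans (expect_mono hy)
  rw [Finset.expect_add_distrib, Finset.expect_add_distrib, ← Finset.mul_expect,
    Finset.expect_sub_distrib, Fintype.expect_const, Fintype.expect_const] at hfin
  have h5 : (δ + γ) * θ ≤ (δ + γ) * 𝔼 y, density {z : Fin M → Option κ | ∀ i,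
      y ∈ S (fillBlocks (some ∘ l i) (Sum.elim z w ∘ e₂))} := by gcongr
  have h6 : 0 < γ * θ := by positivity
  nlinarith

lemma DensityHalesJewett.of_equiv {κ κ' : Type} [Fintype κ] [Fintype κ'] (e : κ ≃ κ')
    (h : DensityHalesJewett κ) : DensityHalesJewett κ' := by
  intro δ hδ
  obtain ⟨n, hn⟩ := h δ hδ
  refine ⟨n, fun ι _ _ hι A hA => ?_⟩
  obtain ⟨l, hl⟩ := hn ι hι {z | e ∘ z ∈ A} (by
    refine hA.trans (le_of_eq ?_)
    rw [← density_preimage_equiv (Equiv.arrowCongr (Equiv.refl ι) e) A]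
    rfl)
  refine ⟨l.map e, fun x => ?_⟩
  have := hl (e.symm x)
  rw [Set.mem_ofPred_eq, ← Line.map_apply] at this
  simpa using this

/-- The **density Hales-Jewett theorem**. -/
theorem densityHalesJewett_fin (k : ℕ) : DensityHalesJewett (Fin (k + 1)) := by
  induction k with
  | zero =>
    refine fun δ hδ => ⟨1, fun ι _ _ hι A hA => ?_⟩
    have : Nonempty ι := Fintype.card_pos_iff.1 hι
    obtain ⟨z, hz⟩ := nonempty_of_density_pos (hδ.trans_le hA)
    exact ⟨Line.diagonal _ ι, fun x => by
      rwa [show Line.diagonal (Fin (0 + 1)) ι x = z from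
        funext fun i => Subsingleton.elim (α := Fin 1) _ _]⟩
  | succ k ih => exact ih.option.of_equiv (finSuccEquiv (k + 1)).symm

/-! ### Letter counts: from lines to homothetic copies of the unit vectors -/

section Counting

variable {α ι : Type*} [Fintype ι] [DecidableEq α]

/-- The number of occurrences of each letter in a word. -/
def letterCount (w : ι → α) (a : α) : ℤ := ((Finset.univ.filter fun b => w b = a).card : ℤ)

lemma letterCount_nonneg (w : ι → α) (a : α) : 0 ≤ letterCount w a := Int.natCast_nonneg _

lemma letterCount_le (w : ι → α) (a : α) : letterCount w a ≤ Fintype.card ι := by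
  unfold letterCount
  exact_mod_cast Finset.card_le_univ _

lemma sum_letterCount [Fintype α] (w : ι → α) : ∑ a, letterCount w a = Fintype.card ι := by
  unfold letterCount
  rw [← Nat.cast_sum, ← Finset.card_eq_sum_card_fiberwise (fun _ _ => by simp), Finset.card_univ]

/-- The number of coordinates at which a line takes each constant value. -/
def Combinatorics.Line.constCount (l : Line α ι) (a : α) : ℤ := letterCount l.idxFun (some a)

/-- The number of active coordinates of a line. -/
def Combinatorics.Line.activeCount (l : Line α ι) : ℤ := letterCount l.idxFun none

lemma Combinatorics.Line.activeCount_pos (l : Line α ι) : 0 < l.activeCount := by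
  obtain ⟨b, hb⟩ := l.proper
  unfold activeCount letterCount
  exact_mod_cast Finset.card_pos.2 ⟨b, by simp [hb]⟩

lemma Combinatorics.Line.letterCount_apply (l : Line α ι) (x : α) :
    letterCount (l x) = l.constCount + l.activeCount • Pi.single x 1 := by
  classical
  funext a
  simp only [constCount, activeCount, letterCount, Pi.add_apply, Pi.smul_apply, smul_eq_mul,
    Pi.single_apply]
  split_ifs with h
  · subst h
    rw [mul_one, ← Nat.cast_add, ← Finset.card_union_of_disjoint]
    · congr 2
      ext b
      rw [Finset.mem_union, Finset.mem_filter, Finset.mem_filter, Finset.mem_filter, Line.coe_apply]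
      cases l.idxFun b <;> simp
    · rw [Finset.disjoint_filter]
      intro b _ h1 h2
      simp [h1] at h2
  · rw [mul_zero, add_zero]
    congr 2
    ext b
    rw [Finset.mem_filter, Finset.mem_filter, Line.coe_apply]
    cases l.idxFun b <;> simp [Ne.symm h]

lemma Combinatorics.Line.sum_constCount [Fintype α] (l : Line α ι) :
    ∑ a, l.constCount a = Fintype.card ι - l.activeCount := by
  have := sum_letterCount l.idxFun
  rw [Fintype.sum_option] at this
  unfold constCount activeCount
  linarith

end Counting

/-! ### Translates, dilations and the count of apexes -/

section Corners

variable {k : ℕ}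

/-- The vector with prescribed sum and prescribed coordinates after the first one. -/
def vectorOfSum (s : ℤ) (u : Fin k → ℤ) : Fin (k + 1) → ℤ := Fin.cons (s - ∑ i, u i) u

lemma sum_vectorOfSum (s : ℤ) (u : Fin k → ℤ) : ∑ i, vectorOfSum s u i = s := by
  simp [vectorOfSum, Fin.sum_univ_succ]

lemma vectorOfSum_succ (s : ℤ) (u : Fin k → ℤ) (i : Fin k) : vectorOfSum s u i.succ = u i := by
  simp [vectorOfSum]

lemma eq_of_sum_eq_of_succ {x y : Fin (k + 1) → ℤ} (h : ∑ i, x i = ∑ i, y i)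
    (hs : ∀ i : Fin k, x i.succ = y i.succ) : x = y := by
  rw [Fin.sum_univ_succ, Fin.sum_univ_succ, Finset.sum_congr rfl fun i _ => hs i] at h
  funext i
  exact Fin.cases (by linarith) hs i

/-- For j ≠ i, the i-th coordinate of `a` is that of a point of `S`, namely `a` moved along the j-th
unit vector. Such a j exists because k ≥ 1. -/
lemma finite_simplexApexes (N : ℕ) (hk : 1 ≤ k) {S : Set (Fin (k + 1) → ℤ)}
    (hS : S ⊆ simplexSlice N k) : (simplexApexes N k S).Finite := by
  refine (Set.finite_Icc (fun _ : Fin (k + 1) => (0 : ℤ)) fun _ => (N : ℤ) - 1).subset ?_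
  rintro a ⟨-, -, ha⟩
  have key : ∀ i, 0 ≤ a i ∧ a i ≤ (N : ℤ) - 1 := by
    intro i
    have : Nontrivial (Fin (k + 1)) := Fin.nontrivial_iff_two_le.2 (by omega)
    obtain ⟨j, hj⟩ := exists_ne i
    have h1 := (hS (ha ⟨Pi.single j 1, ⟨j, rfl⟩, rfl⟩)).1 i
    simpa [hj.symm] using h1
  exact ⟨fun i => (key i).1, fun i => (key i).2⟩

/-- The homothetic copies of a configuration of words which are met by a dense subset of the
simplex slice. -/
lemma le_density_vectorOfSum {N n k : ℕ} {S : Set (Fin (k + 1) → ℤ)} (hS : S ⊆ simplexSlice N k)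
    {d : ℤ} (hd : 0 ≤ d) (hdn : d * n ≤ N) (w : Fin n → Fin (k + 1)) :
    (S.ncard : ℝ) / (2 * N) ^ k ≤ density {u : Fin k → Finset.Ico (-(N : ℤ)) N |
      vectorOfSum (N - 1 - d * n) (fun i => (u i : ℤ)) + d • letterCount w ∈ S} := by
  have hcnt : ∀ i, 0 ≤ d * letterCount w i ∧ d * letterCount w i ≤ N := fun i =>
    ⟨mul_nonneg hd (letterCount_nonneg _ _), (mul_le_mul_of_nonneg_left
      (by simpa using letterCount_le w i) hd).trans hdn⟩
  have hcard : (Fintype.card (Fin k → Finset.Ico (-(N : ℤ)) N) : ℝ) = (2 * N) ^ k := by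
    rw [Fintype.card_fun, Fintype.card_coe, Int.card_Ico, Fintype.card_fin]
    push_cast
    congr 1
    have : ((N : ℤ) - -N).toNat = 2 * N := by omega
    rw [this]
    push_cast
    ring
  rw [density_eq_ncard, hcard]
  gcongr
  let g : (Fin k → Finset.Ico (-(N : ℤ)) N) → (Fin (k + 1) → ℤ) := fun u =>
    vectorOfSum (N - 1 - d * n) (fun i => (u i : ℤ)) + d • letterCount w
  refine (Set.ncard_le_ncard (t := g '' {u | g u ∈ S}) (fun s hs => ?_)
    (Set.toFinite _)).trans (Set.ncard_image_le (Set.toFinite _))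
  have hs' := hS hs
  -- The translate hitting `s` is forced. Its free coordinates lie in [-N, N), as a coordinate of
  -- `s` lies in [0, N) and the subtracted term in [0, N].
  have hgs : g (fun i => ⟨s i.succ - d * letterCount w i.succ, Finset.mem_Ico.2 (by
      have := hs'.1 i.succ
      have := hcnt i.succ
      constructor <;> linarith)⟩) = s := by
    refine eq_of_sum_eq_of_succ ?_ fun i => ?_
    · simp only [g, Pi.add_apply, Pi.smul_apply, smul_eq_mul]
      rw [Finset.sum_add_distrib, sum_vectorOfSum, ← Finset.mul_sum, sum_letterCount, hs'.2]
      simp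
    · simp only [g, Pi.add_apply, Pi.smul_apply, smul_eq_mul, vectorOfSum_succ]
      ring
  exact ⟨_, by rw [Set.mem_ofPred_eq, hgs]; exact hs, hgs⟩

lemma mem_simplexApexes_of_line {N n k : ℕ} {S : Set (Fin (k + 1) → ℤ)} {d : ℤ} (hd : 0 < d)
    (l : Line (Fin (k + 1)) (Fin n)) {t : Fin (k + 1) → ℤ} (ht : ∑ i, t i = N - 1 - d * n)
    (h : ∀ x, t + d • letterCount (l x) ∈ S) :
    slack N (t + d • l.constCount) = d * l.activeCount ∧
      t + d • l.constCount ∈ simplexApexes N k S := by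
  have hslack : slack N (t + d • l.constCount) = d * l.activeCount := by
    simp only [slack, Pi.add_apply, Pi.smul_apply, smul_eq_mul]
    rw [Finset.sum_add_distrib, ht, ← Finset.mul_sum, l.sum_constCount, Fintype.card_fin]
    ring
  have hpos : 0 < d * l.activeCount := mul_pos hd l.activeCount_pos
  refine ⟨hslack, fun hmem => ?_, by rw [hslack]; exact hpos.ne', ?_⟩
  · have h1 := hmem.2
    rw [slack, h1] at hslack
    linarith
  · rintro _ ⟨_, ⟨x, rfl⟩, rfl⟩
    have h1 := h x
    rw [l.letterCount_apply, smul_add, smul_smul, ← add_assoc] at h1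
    simpa only [hslack] using h1

end Corners

theorem mainTheorem6 (δ : ℝ) (hδ : 0 < δ) (k : ℕ) (hk : 1 ≤ k) :
    ∃ ε : ℝ, 0 < ε ∧ ∃ N₀ : ℕ, ∀ N : ℕ, N₀ ≤ N →
      ∀ S : Set (Fin (k + 1) → ℤ), S ⊆ simplexSlice N k →
        δ * (N : ℝ) ^ k ≤ (S.ncard : ℝ) →
          (simplexApexes N k S).Nonempty ∧
            ε * (N : ℝ) ^ (k + 1) ≤ ((simplexApexes N k S).ncard : ℝ) := by
  classical
  set δ' : ℝ := δ / 2 ^ k with hδ'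
  have hδ'0 : 0 < δ' := by positivity
  obtain ⟨n₀, hn₀⟩ := densityHalesJewett_fin k (δ' / 2) (by positivity)
  obtain ⟨n, hn, hn1⟩ : ∃ n, n₀ ≤ n ∧ 1 ≤ n := ⟨max n₀ 1, le_max_left _ _, le_max_right _ _⟩
  have hn0 : (0 : ℝ) < n := by exact_mod_cast hn1
  have hC : (0 : ℝ) < Fintype.card (Fin n → Option (Fin (k + 1))) := by
    exact_mod_cast Fintype.card_pos
  set θ : ℝ := δ' / 2 / Fintype.card (Fin n → Option (Fin (k + 1))) with hθ
  have hθ0 : 0 < θ := by positivity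
  -- A proportion θ of (2N)^k translates and M ≥ N / (2n) dilations.
  refine ⟨θ * 2 ^ k / (2 * n), by positivity, n, fun N hN S hS hSd => ?_⟩
  have hN0 : (0 : ℝ) < N := hn0.trans_le (by exact_mod_cast hN)
  suffices hmain : θ * 2 ^ k / (2 * n) * (N : ℝ) ^ (k + 1) ≤ ((simplexApexes N k S).ncard : ℝ) by
    refine ⟨?_, hmain⟩
    have h1 : (0 : ℝ) < ((simplexApexes N k S).ncard : ℝ) :=
      lt_of_lt_of_le (by positivity) hmain
    exact Set.nonempty_of_ncard_ne_zero (by exact_mod_cast h1.ne')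
  obtain ⟨M, hM⟩ : ∃ M, M = N / n := ⟨_, rfl⟩
  have hM1 : 1 ≤ M := hM ▸ (Nat.one_le_div_iff hn1).2 hN
  have hMn : M * n ≤ N := hM ▸ Nat.div_mul_le_self N n
  have hMN : (N : ℝ) / (2 * n) ≤ M := by
    rw [div_le_iff₀ (by positivity)]
    have h1 : N < n * (M + 1) := hM ▸ Nat.lt_mul_div_succ N hn1
    have h2 : N ≤ M * (2 * n) := by nlinarith
    exact_mod_cast h2
  have : Nonempty (Fin M) := ⟨⟨0, hM1⟩⟩
  have hIco : Nonempty (Finset.Ico (-(N : ℤ)) N) :=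
    ⟨⟨0, Finset.mem_Ico.2 ⟨by omega, by omega⟩⟩⟩
  let X := (Fin k → Finset.Ico (-(N : ℤ)) N) × Fin M
  let D : X → ℤ := fun p => (p.2 : ℤ) + 1
  let τ : X → Fin (k + 1) → ℤ := fun p => vectorOfSum (N - 1 - D p * n) fun i => (p.1 i : ℤ)
  let A : X → Set (Fin n → Fin (k + 1)) := fun p => {w | τ p + D p • letterCount w ∈ S}
  have hA : δ' ≤ 𝔼 p, density (A p) := by
    simp only [density]
    rw [Finset.expect_comm]
    refine Finset.le_expect Finset.univ_nonempty fun w _ => ?_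
    rw [expect_prod_comm]
    refine Finset.le_expect Finset.univ_nonempty fun d _ => ?_
    refine le_trans ?_ (le_density_vectorOfSum hS (d := (d : ℤ) + 1) (by positivity) ?_ w)
    · rw [hδ', div_le_div_iff₀ (by positivity) (by positivity), mul_pow]
      nlinarith [show (0 : ℝ) < 2 ^ k by positivity]
    · have h1 : ((d : ℕ) + 1) * n ≤ N := (Nat.mul_le_mul_right n d.2).trans hMn
      exact_mod_cast h1
  have hgood := half_le_density_half_le hδ'0.le (fun p => density_le_one (A p)) hA
  -- Pigeonhole over the line templates, whose number does not depend on `N`.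
  obtain ⟨q, hq⟩ := exists_density_ge (A := {p | δ' / 2 ≤ density (A p)})
    (fun q : Fin n → Option (Fin (k + 1)) =>
      {p | ∃ l : Line (Fin (k + 1)) (Fin n), l.idxFun = q ∧ ∀ x, l x ∈ A p}) (fun p hp => by
        obtain ⟨l, hl⟩ := hn₀ (Fin n) (by simpa using hn) _ hp
        exact Set.mem_iUnion.2 ⟨l.idxFun, l, rfl, hl⟩)
  replace hq := (div_le_div_of_nonneg_right hgood hC.le).trans hq
  obtain ⟨-, l, rfl, -⟩ := nonempty_of_density_pos (hθ0.trans_le hq)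
  set G : Set X := {p | ∀ x, l x ∈ A p} with hG
  replace hq : θ ≤ density G := hq.trans (density_mono (by
    rintro p ⟨l', h1, h2⟩
    obtain rfl : l' = l := Line.ext h1
    exact h2))
  have hcard : (Fintype.card X : ℝ) = (2 * N) ^ k * M := by
    rw [Fintype.card_prod, Fintype.card_fun, Fintype.card_coe, Int.card_Ico, Fintype.card_fin,
      Fintype.card_fin, show ((N : ℤ) - -N).toNat = 2 * N by omega]
    push_cast
    ring
  have hXpos : (0 : ℝ) < Fintype.card X := by exact_mod_cast Fintype.card_pos
  rw [density_eq_ncard, le_div_iff₀ hXpos, hcard] at hq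
  have hGa : ∀ p ∈ G, slack N (τ p + D p • l.constCount) = D p * l.activeCount ∧
      τ p + D p • l.constCount ∈ simplexApexes N k S := fun p hp =>
    mem_simplexApexes_of_line (show (0 : ℤ) < (p.2 : ℤ) + 1 by positivity) l
      (sum_vectorOfSum _ _) hp
  have hle : G.ncard ≤ (simplexApexes N k S).ncard := by
    -- The slack of the apex determines the dilation, because `l` is fixed with a nonzero active
    -- count; the translate is then determined too.
    refine Set.ncard_le_ncard_of_injOn (fun p => τ p + D p • l.constCount)
      (fun p hp => (hGa p hp).2) (fun p hp p' hp' hpp => ?_) (finite_simplexApexes N hk hS)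
    have h1 : D p * l.activeCount = D p' * l.activeCount := by
      rw [← (hGa p hp).1, ← (hGa p' hp').1]
      exact congrArg (slack N) hpp
    have h2 : D p = D p' := mul_right_cancel₀ l.activeCount_pos.ne' h1
    have h3 : τ p = τ p' := by
      simp only [h2] at hpp
      exact add_right_cancel hpp
    refine Prod.ext (funext fun i => Subtype.ext ?_) (Fin.ext ?_)
    · have := congrFun h3 i.succ
      simpa only [τ, vectorOfSum_succ] using this
    · simp only [D] at h2
      omega
  calc θ * 2 ^ k / (2 * n) * (N : ℝ) ^ (k + 1) = θ * ((2 * N) ^ k * (N / (2 * n))) := by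
        rw [mul_pow, pow_succ]; ring
    _ ≤ θ * ((2 * N) ^ k * M) := by gcongr
    _ ≤ G.ncard := hq
    _ ≤ (simplexApexes N k S).ncard := by exact_mod_cast hle
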